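/- Let $G=(V,E)$ be a graph on $n$ nodes and $w\in(0,\infty)^{E}$ a vector of edge weights, with weighted Laplacian $L_w$. Consider the noisy consensus dynamics $dx(t)=-L_w x(t)\,dt+dB(t)$, $x(0)=x_0\in\mathbb{R}^V$, where $B$ is a standard Brownian motion in $\mathbb{R}^V$; thus $x(t)$ is Gaussian with mean $e^{-tL_w}x_0$ and covariance $\int_0^t e^{-sL_w}(e^{-sL_w})^{\top}ds$. Let $\tilde x(t)$ be the average of the entries of $x(t)$, and put $$\mathcal H(G,w)=\lim_{t\to\infty}\frac1n\sum_{i\in V}\mathbb{E}\big[(x_i(t)-\tilde x(t))^2\big]\in[0,\infty],\qquad \mathcal H^*(G)=\inf_{0<w\le 1}\mathcal H(G,w)$$ (the infimum is over weights with $0<w_e\le1$ for all $e\in E$; $\mathcal H^*(G)=\infty$ if $G$ is disconnected). Given a graph $G=(V,E)$, capacities $c_e\in\mathbb{Z}_{\ge0}$ for $e\in E$, and $k\in\mathbb{Z}_{\ge0}$, consider the problem $$\min_{E_1,\dots,E_k\subseteq E}\ \sum_{\ell=1}^k\mathcal H^*(G_\ell),\quad G_\ell=(V,E_\ell),\qquad\text{subject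 to}\quad |\{\ell: e\in E_\ell\}|\le c_e\ \text{ for all } e\in E. \tag{P}$$ **Theorem.** Let $G$ be the complete graph on $n\ge3$ nodes, let $k=\alpha n$ for some integer $\alpha\ge0$, and let every edge have capacity $2\alpha$. Then, for any choice of the initial states of the $k$ dimensions, (P) has an optimal solution, and it is unique up to the order of $G_1,\dots,G_k$. More precisely, $(G_1,\dots,G_k)$ is an optimal solution of (P) if and only if every $G_\ell$ is a star graph on $V$ (a hub joined to all other nodes, and no other edges) and each node is the hub of exactly $\alpha$ of the stars. -/

import Mathlib

open scoped ENNReal Matrix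

namespace ConsensusNetwork

noncomputable section

open Classical in
/-- The weighted Laplacian of a graph: off the diagonal the entry is minus the weight of the edge
(`0` if the two nodes are not adjacent), and every row sums to zero. -/
def weightedLaplacian {V : Type*} [Fintype V] (G : SimpleGraph V) (w : Sym2 V → ℝ) :
    Matrix V V ℝ :=
  Matrix.of fun i j =>
    if i = j then ∑ u, (if G.Adj i u then w s(i, u) else 0)
    else if G.Adj i j then -w s(i, j) else 0

/-- The covariance at time `t` of the solution of `dx = -L x dt + dB` with deterministic
initial state (`B` a standard Brownian motion in `ℝ^V`), namely
`∫₀ᵗ exp(-sL) exp(-sL)ᵀ ds`, taken entry by entry. -/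
def noiseCovariance {V : Type*} [Fintype V] [DecidableEq V] (L : Matrix V V ℝ) (t : ℝ) :
    Matrix V V ℝ :=
  Matrix.of fun i j =>
    ∫ s in (0 : ℝ)..t, (NormedSpace.exp (-s • L) * (NormedSpace.exp (-s • L))ᵀ) i j

/-- The law at time `t` of the noisy consensus dynamics `dx = -L x dt + dB`, `x(0) = x₀`:
the Gaussian law of `x(t) = exp(-tL) x₀ + ∫₀ᵗ exp(-(t-s)L) dB(s)`. -/
def stateLaw {V : Type*} [Fintype V] [DecidableEq V] (L : Matrix V V ℝ) (x₀ : V → ℝ) (t : ℝ) :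
    MeasureTheory.Measure (EuclideanSpace ℝ V) :=
  ProbabilityTheory.multivariateGaussian
    (WithLp.toLp 2 (NormedSpace.exp (-t • L) *ᵥ x₀)) (noiseCovariance L t)

/-- The population variance `(1/n) ∑ i, (x i - average of x)²` of a state vector. -/
def populationVariance {V : Type*} [Fintype V] (x : EuclideanSpace ℝ V) : ℝ :=
  (∑ i, (x i - (∑ j, x j) / Fintype.card V) ^ 2) / Fintype.card V

/-- The expected population variance in steady state, `lim_{t → ∞}` of the expected population
variance, with values in `[0, ∞]`. -/
def steadyStateVariance {V : Type*} [Fintype V] [DecidableEq V]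
    (G : SimpleGraph V) (w : Sym2 V → ℝ) (x₀ : V → ℝ) : ℝ≥0∞ :=
  Filter.limsup
    (fun t : ℝ => ∫⁻ x, ENNReal.ofReal (populationVariance x)
      ∂(stateLaw (weightedLaplacian G w) x₀ t))
    Filter.atTop

/-- The structural robustness measure `H*`: the smallest steady state variance under edge
weights in `(0, 1]`. It is `∞` if the graph is not connected. -/
def structuralVariance {V : Type*} [Fintype V] [DecidableEq V]
    (G : SimpleGraph V) (x₀ : V → ℝ) : ℝ≥0∞ :=
  ⨅ (w : Sym2 V → ℝ) (_ : ∀ e ∈ G.edgeSet, 0 < w e ∧ w e ≤ 1), steadyStateVariance G w x₀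

/-- An assignment of the edges of `G` to the `k` state dimensions: subgraphs `H 0, …, H (k-1)`
of `G` on all nodes such that each edge `e` of `G` lies in at most `c e` of them. -/
def IsFeasible {V : Type*} (G : SimpleGraph V) (c : Sym2 V → ℕ) {k : ℕ}
    (H : Fin k → SimpleGraph V) : Prop :=
  (∀ l, H l ≤ G) ∧ ∀ e ∈ G.edgeSet, {l | e ∈ (H l).edgeSet}.ncard ≤ c e

/-- The cost of an assignment; `x₀ l` is the initial state of the `l`-th dimension. -/
def totalCost {V : Type*} [Fintype V] [DecidableEq V] {k : ℕ}
    (x₀ : Fin k → V → ℝ) (H : Fin k → SimpleGraph V) : ℝ≥0∞ :=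
  ∑ l, structuralVariance (H l) (x₀ l)

/-- `H` is an optimal solution: it minimizes the cost over all feasible assignments. -/
def IsOptimal {V : Type*} [Fintype V] [DecidableEq V] (G : SimpleGraph V) (c : Sym2 V → ℕ)
    {k : ℕ} (x₀ : Fin k → V → ℝ) (H : Fin k → SimpleGraph V) : Prop :=
  IsFeasible G c H ∧
    ∀ H' : Fin k → SimpleGraph V, IsFeasible G c H' → totalCost x₀ H ≤ totalCost x₀ H'

end

end ConsensusNetwork

/-! Write `n` for the number of nodes and `C` for the projection onto vectors of sum zero. Since `L
* Cov(t) = (1 - exp(-2tL)) / 2`, any `X` with `X L = C` and `X C = X` gives the steady-state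
variance `tr X / (2n)`, whatever the initial state (`steadyStateVariance_eq_of_pseudoinverse`). On a
disconnected graph some sum-zero mode is undamped and the cost is infinite.

For a tree, `X` is the sum over edges of `w_e⁻¹ p_e p_eᵀ`, where `p_e` is the centered indicator of
one side of `e`. An edge that splits off `s` nodes thus contributes `s(n - s) / n` times `w_e⁻¹` to
`tr X`, so unit weights are optimal. As `s(n - s) = (n - 1) + (s - 1)(n - 1 - s)`, a tree costs at
least as much as a star, with equality only if every edge is a leaf edge, that is, for a star.

The total capacity `2α · n(n - 1)/2 = k(n - 1)` is just enough for `k` spanning trees, so finite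
cost forces every `H l` to be a tree, and `k` stars are a lower bound. With `a v` stars hubbed at
`v`, feasibility reads `a u + a v ≤ 2α` for `u ≠ v`; with `∑ a = αn` and `n ≥ 3` this means `a = α`.
-/

open scoped ENNReal Matrix

namespace ConsensusNetwork

open Matrix MeasureTheory ProbabilityTheory Filter Topology

/-! ### Matrix exponential and noise covariance of a positive semidefinite matrix -/

section Spectral

variable {V : Type*} [Fintype V] [DecidableEq V]

theorem exists_orthogonal_diagonalization {L : Matrix V V ℝ} (hL : L.PosSemidef) :
    ∃ (U : Matrix V V ℝ) (d : V → ℝ), Uᵀ * U = 1 ∧ U * Uᵀ = 1 ∧ (∀ i, 0 ≤ d i) ∧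
      L = U * diagonal d * Uᵀ := by
  refine ⟨hL.1.eigenvectorUnitary, hL.1.eigenvalues, ?_, ?_, hL.eigenvalues_nonneg, ?_⟩
  · have := Unitary.coe_star_mul_self hL.1.eigenvectorUnitary
    rwa [star_eq_conjTranspose, conjTranspose_eq_transpose_of_trivial] at this
  · have := Unitary.coe_mul_star_self hL.1.eigenvectorUnitary
    rwa [Unitary.coe_star, star_eq_conjTranspose, conjTranspose_eq_transpose_of_trivial] at this
  · have := hL.1.spectral_theorem
    rwa [Unitary.conjStarAlgAut_apply, star_eq_conjTranspose,
      conjTranspose_eq_transpose_of_trivial] at this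

theorem exp_smul_conj_diagonal {U : Matrix V V ℝ} {d : V → ℝ} (h1 : Uᵀ * U = 1)
    (h2 : U * Uᵀ = 1) (s : ℝ) :
    NormedSpace.exp (s • (U * diagonal d * Uᵀ)) =
      U * diagonal (fun i => Real.exp (s * d i)) * Uᵀ := by
  have hU : IsUnit U := ⟨⟨U, Uᵀ, h2, h1⟩, rfl⟩
  have hinv : U⁻¹ = Uᵀ := inv_eq_right_inv h2
  have : s • (U * diagonal d * Uᵀ) = U * diagonal (fun i => s * d i) * U⁻¹ := by
    rw [hinv, ← smul_mul_assoc, ← mul_smul_comm, ← diagonal_smul]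
    rfl
  rw [this, exp_conj _ _ hU, exp_diagonal, hinv]
  congr 3
  ext i
  rw [Pi.coe_exp, Real.exp_eq_exp_ℝ]

theorem conj_diagonal_mul {U : Matrix V V ℝ} (h1 : Uᵀ * U = 1) (d e : V → ℝ) :
    (U * diagonal d * Uᵀ) * (U * diagonal e * Uᵀ) = U * diagonal (fun i => d i * e i) * Uᵀ := by
  rw [← diagonal_mul_diagonal]
  calc _ = U * diagonal d * (Uᵀ * U) * diagonal e * Uᵀ := by simp only [Matrix.mul_assoc]
    _ = _ := by rw [h1, Matrix.mul_one]; simp only [Matrix.mul_assoc]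

theorem transpose_conj_diagonal (U : Matrix V V ℝ) (d : V → ℝ) :
    (U * diagonal d * Uᵀ)ᵀ = U * diagonal d * Uᵀ := by
  simp [transpose_mul, Matrix.mul_assoc]

theorem conj_diagonal_apply (U : Matrix V V ℝ) (d : V → ℝ) (i j : V) :
    (U * diagonal d * Uᵀ) i j = ∑ k, U i k * d k * U j k := by
  rw [mul_apply]
  simp [mul_diagonal]

theorem noiseCovariance_conj_diagonal {U : Matrix V V ℝ} {d : V → ℝ} (h1 : Uᵀ * U = 1)
    (h2 : U * Uᵀ = 1) (t : ℝ) :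
    noiseCovariance (U * diagonal d * Uᵀ) t =
      U * diagonal (fun i => ∫ s in (0 : ℝ)..t, Real.exp (-s * d i) * Real.exp (-s * d i)) *
        Uᵀ := by
  ext i j
  simp only [noiseCovariance, of_apply, exp_smul_conj_diagonal h1 h2, transpose_conj_diagonal,
    conj_diagonal_mul h1, conj_diagonal_apply]
  rw [intervalIntegral.integral_finsetSum]
  · refine Finset.sum_congr rfl fun k _ => ?_
    rw [intervalIntegral.integral_mul_const, intervalIntegral.integral_const_mul]
  · intro k _
    apply Continuous.intervalIntegrable
    fun_prop

theorem posSemidef_conj_diagonal (U : Matrix V V ℝ) {d : V → ℝ} (hd : ∀ i, 0 ≤ d i) :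
    (U * diagonal d * Uᵀ).PosSemidef := by
  have := (posSemidef_diagonal_iff.2 hd).mul_mul_conjTranspose_same U
  rwa [conjTranspose_eq_transpose_of_trivial] at this

theorem posSemidef_noiseCovariance {L : Matrix V V ℝ} (hL : L.PosSemidef) {t : ℝ} (ht : 0 ≤ t) :
    (noiseCovariance L t).PosSemidef := by
  obtain ⟨U, d, h1, h2, -, rfl⟩ := exists_orthogonal_diagonalization hL
  rw [noiseCovariance_conj_diagonal h1 h2]
  exact posSemidef_conj_diagonal U fun i =>
    intervalIntegral.integral_nonneg ht fun s _ => by positivity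

/-- The factor `a` stays on the left so that the eigenvalue `0` needs no separate case. -/
theorem mul_integral_exp_sq (a t : ℝ) :
    a * ∫ s in (0 : ℝ)..t, Real.exp (-s * a) * Real.exp (-s * a) =
      (1 - Real.exp (-(2 * t) * a)) / 2 := by
  rw [← intervalIntegral.integral_const_mul]
  have : ∀ s ∈ Set.uIcc 0 t, HasDerivAt (fun s => -Real.exp (-(2 * s) * a) / 2)
      (a * (Real.exp (-s * a) * Real.exp (-s * a))) s := by
    intro s _
    have h0 : HasDerivAt (fun s : ℝ => -(2 * s) * a) (-(2 * 1) * a) s :=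
      (((hasDerivAt_id s).const_mul 2).neg).mul_const a
    refine ((h0.exp.neg).div_const 2).congr_deriv ?_
    rw [← Real.exp_add]
    ring_nf
  rw [intervalIntegral.integral_eq_sub_of_hasDerivAt this
    (Continuous.intervalIntegrable (by fun_prop) _ _)]
  simp
  ring

/-- Integrates `d/ds exp(-2sL) = -2L exp(-2sL)`. A Laplacian is singular, hence no division by `L`.
-/
theorem mul_noiseCovariance {L : Matrix V V ℝ} (hL : L.PosSemidef) (t : ℝ) :
    L * noiseCovariance L t = (2⁻¹ : ℝ) • (1 - NormedSpace.exp (-(2 * t) • L)) := by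
  obtain ⟨U, d, h1, h2, -, rfl⟩ := exists_orthogonal_diagonalization hL
  rw [noiseCovariance_conj_diagonal h1 h2, conj_diagonal_mul h1, exp_smul_conj_diagonal h1 h2]
  simp only [mul_integral_exp_sq]
  ext i j
  have h3 : (1 : Matrix V V ℝ) i j = ∑ k, U i k * U j k := by
    rw [← h2, mul_apply]; rfl
  rw [Matrix.smul_apply, Matrix.sub_apply, conj_diagonal_apply, conj_diagonal_apply, h3,
    ← Finset.sum_sub_distrib, smul_eq_mul, Finset.mul_sum]
  exact Finset.sum_congr rfl fun k _ => by ring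

/-- Modes with positive eigenvalue decay; the factor `L` removes the null modes, on which the
exponential is the identity. -/
theorem tendsto_mul_exp_neg_smul {L : Matrix V V ℝ} (hL : L.PosSemidef) :
    Tendsto (fun t : ℝ => L * NormedSpace.exp (-t • L)) atTop (𝓝 0) := by
  obtain ⟨U, d, h1, h2, hd, rfl⟩ := exists_orthogonal_diagonalization hL
  simp only [exp_smul_conj_diagonal h1 h2, conj_diagonal_mul h1]
  refine tendsto_pi_nhds.2 fun i => tendsto_pi_nhds.2 fun j => ?_
  simp only [conj_diagonal_apply]
  rw [show (0 : Matrix V V ℝ) i j = ∑ k : V, U i k * 0 * U j k by simp]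
  refine tendsto_finsetSum _ fun k _ => (Tendsto.const_mul _ ?_).mul_const _
  rcases (hd k).eq_or_lt with h | h
  · simp [← h]
  · have h3 : Tendsto (fun t : ℝ => Real.exp (-t * d k)) atTop (𝓝 0) := by
      refine Real.tendsto_exp_atBot.comp ?_
      simp only [neg_mul]
      exact tendsto_neg_atTop_atBot.comp (tendsto_id.atTop_mul_const h)
    simpa using h3.const_mul (d k)

theorem exp_smul_mulVec_of_ker {L : Matrix V V ℝ} (hL : L.PosSemidef) {v : V → ℝ}
    (hv : L *ᵥ v = 0) (s : ℝ) : NormedSpace.exp (s • L) *ᵥ v = v := by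
  obtain ⟨U, d, h1, h2, -, rfl⟩ := exists_orthogonal_diagonalization hL
  rw [exp_smul_conj_diagonal h1 h2]
  set c := Uᵀ *ᵥ v with hc
  have hd : diagonal d *ᵥ c = 0 := by
    have := congrArg (Uᵀ *ᵥ ·) hv
    simp only [mulVec_zero] at this
    rwa [← mulVec_mulVec, ← mulVec_mulVec, mulVec_mulVec, h1, one_mulVec] at this
  have hD : diagonal (fun i => Real.exp (s * d i)) *ᵥ c = c := by
    ext i
    have := congrFun hd i
    rw [mulVec_diagonal, Pi.zero_apply] at this
    rw [mulVec_diagonal]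
    rcases mul_eq_zero.1 this with h | h <;> simp [h]
  rw [← mulVec_mulVec, ← mulVec_mulVec, ← hc, hD, hc, mulVec_mulVec, h2, one_mulVec]

/-- The exponential fixes kernel vectors, so noise accumulates there undamped. This is the source of
infinite cost. -/
theorem noiseCovariance_mulVec_of_ker {L : Matrix V V ℝ} (hL : L.PosSemidef) {v : V → ℝ}
    (hv : L *ᵥ v = 0) (t : ℝ) : noiseCovariance L t *ᵥ v = t • v := by
  have hcont : ∀ i j, Continuous fun s : ℝ =>
      (NormedSpace.exp (-s • L) * (NormedSpace.exp (-s • L))ᵀ) i j := by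
    obtain ⟨U, d, h1, h2, -, rfl⟩ := exists_orthogonal_diagonalization hL
    intro i j
    simp only [exp_smul_conj_diagonal h1 h2, transpose_conj_diagonal,
      conj_diagonal_mul h1, conj_diagonal_apply]
    fun_prop
  have hsymm : ∀ s : ℝ, (NormedSpace.exp (s • L))ᵀ = NormedSpace.exp (s • L) := by
    obtain ⟨U, d, h1, h2, -, rfl⟩ := exists_orthogonal_diagonalization hL
    intro s
    rw [exp_smul_conj_diagonal h1 h2, transpose_conj_diagonal]
  ext i
  have hsum : (noiseCovariance L t *ᵥ v) i = ∫ s in (0 : ℝ)..t,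
      ∑ j, (NormedSpace.exp (-s • L) * (NormedSpace.exp (-s • L))ᵀ) i j * v j := by
    rw [intervalIntegral.integral_finsetSum]
    swap
    · exact fun j _ => ((hcont i j).mul continuous_const).intervalIntegrable _ _
    exact Finset.sum_congr rfl fun j _ => (intervalIntegral.integral_mul_const _ _).symm
  rw [hsum]
  have : ∀ s : ℝ, ∑ j, (NormedSpace.exp (-s • L) * (NormedSpace.exp (-s • L))ᵀ) i j * v j
      = v i := by
    intro s
    have h := exp_smul_mulVec_of_ker hL hv (-s)
    have h' : (NormedSpace.exp (-s • L) * (NormedSpace.exp (-s • L))ᵀ) *ᵥ v = v := by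
      rw [hsymm, ← mulVec_mulVec, h, h]
    exact congrFun h' i
  simp only [this]
  simp

end Spectral

/-! ### Second moments of linear functionals of a Gaussian vector -/

section Gaussian

variable {V : Type*} [Fintype V] [DecidableEq V]

theorem lintegral_sq_dotProduct_multivariateGaussian (m : EuclideanSpace ℝ V)
    {S : Matrix V V ℝ} (hS : S.PosSemidef) (a : V → ℝ) :
    ∫⁻ x : EuclideanSpace ℝ V, ENNReal.ofReal ((a ⬝ᵥ x) ^ 2) ∂(multivariateGaussian m S) =
      ENNReal.ofReal (a ⬝ᵥ S *ᵥ a + (a ⬝ᵥ m) ^ 2) := by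
  set μ := multivariateGaussian m S
  have hid : MemLp id 2 μ := IsGaussian.memLp_two_id
  have hin : ∀ x : EuclideanSpace ℝ V, inner ℝ (WithLp.toLp 2 a) x = a ⬝ᵥ x := by
    intro x
    simp [PiLp.inner_apply, dotProduct, mul_comm]
  have hmem : MemLp (fun x : EuclideanSpace ℝ V => a ⬝ᵥ x) 2 μ := by
    have := hid.const_inner (𝕜 := ℝ) (WithLp.toLp 2 a)
    simpa only [id, hin] using this
  have hvar : variance (fun x : EuclideanSpace ℝ V => a ⬝ᵥ x) μ = a ⬝ᵥ S *ᵥ a := by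
    have h1 := covarianceBilin_multivariateGaussian (μ := m) hS (WithLp.toLp 2 a)
      (WithLp.toLp 2 a)
    rw [covarianceBilin_self hid] at h1
    simpa only [hin] using h1
  have hmean : ∫ x : EuclideanSpace ℝ V, a ⬝ᵥ x ∂μ = a ⬝ᵥ m := by
    have h1 := integral_inner (𝕜 := ℝ) (μ := μ) (f := fun x : EuclideanSpace ℝ V => x)
      (IsGaussian.integrable_id) (WithLp.toLp 2 a)
    simp only [hin] at h1
    rw [h1, integral_id_multivariateGaussian]
  rw [← ofReal_integral_eq_lintegral_ofReal hmem.integrable_sq (ae_of_all _ fun x => sq_nonneg _)]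
  have := variance_eq_sub hmem
  rw [hvar, hmean] at this
  congr 1
  rw [this]
  simp

end Gaussian

/-! ### Quadratic form of the weighted Laplacian -/

section Laplacian

variable {V : Type*} [Fintype V] {G : SimpleGraph V} {w : Sym2 V → ℝ}

theorem weightedLaplacian_transpose (G : SimpleGraph V) (w : Sym2 V → ℝ) :
    (weightedLaplacian G w)ᵀ = weightedLaplacian G w := by
  ext i j
  simp only [weightedLaplacian, transpose_apply, of_apply]
  rcases eq_or_ne i j with rfl | h
  · rfl
  · rw [if_neg h, if_neg h.symm, Sym2.eq_swap]
    by_cases hh : G.Adj i j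
    · rw [if_pos hh, if_pos hh.symm]
    · rw [if_neg hh, if_neg fun h' => hh h'.symm]

open Classical in
theorem weightedLaplacian_mulVec_apply (G : SimpleGraph V) (w : Sym2 V → ℝ) (x : V → ℝ) (i : V) :
    (weightedLaplacian G w *ᵥ x) i = ∑ u, if G.Adj i u then w s(i, u) * (x i - x u) else 0 := by
  have h : ∀ j, weightedLaplacian G w i j * x j =
      (if i = j then (∑ u, if G.Adj i u then w s(i, u) else 0) * x j else 0) +
        if G.Adj i j then -w s(i, j) * x j else 0 := by
    intro j
    simp only [weightedLaplacian, of_apply]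
    rcases eq_or_ne i j with rfl | h
    · simp
    · simp only [if_neg h, zero_add]
      split_ifs <;> simp
  simp only [mulVec, dotProduct, h]
  rw [Finset.sum_add_distrib, Finset.sum_ite_eq, if_pos (Finset.mem_univ _), Finset.sum_mul,
    ← Finset.sum_add_distrib]
  refine Finset.sum_congr rfl fun u _ => ?_
  split_ifs <;> ring

open Classical in
theorem dotProduct_weightedLaplacian_mulVec (G : SimpleGraph V) (w : Sym2 V → ℝ) (x : V → ℝ) :
    x ⬝ᵥ weightedLaplacian G w *ᵥ x =
      2⁻¹ * ∑ i, ∑ u, if G.Adj i u then w s(i, u) * (x i - x u) ^ 2 else 0 := by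
  have h1 : x ⬝ᵥ weightedLaplacian G w *ᵥ x =
      ∑ i, ∑ u, if G.Adj i u then w s(i, u) * (x i - x u) * x i else 0 := by
    simp only [dotProduct, weightedLaplacian_mulVec_apply, Finset.mul_sum]
    refine Finset.sum_congr rfl fun i _ => Finset.sum_congr rfl fun u _ => ?_
    split_ifs <;> ring
  have h2 : x ⬝ᵥ weightedLaplacian G w *ᵥ x =
      ∑ i, ∑ u, if G.Adj i u then w s(i, u) * (x u - x i) * x u else 0 := by
    rw [h1, Finset.sum_comm]
    refine Finset.sum_congr rfl fun i _ => Finset.sum_congr rfl fun u _ => ?_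
    rw [G.adj_comm, Sym2.eq_swap]
  -- Adding the two orientations of each edge completes the square and accounts for the factor
  -- `2⁻¹`.
  have h3 : ∑ i, ∑ u, (if G.Adj i u then w s(i, u) * (x i - x u) ^ 2 else 0) =
      x ⬝ᵥ weightedLaplacian G w *ᵥ x + x ⬝ᵥ weightedLaplacian G w *ᵥ x := by
    nth_rw 1 [h1]
    rw [h2]
    simp only [← Finset.sum_add_distrib]
    refine Finset.sum_congr rfl fun i _ => Finset.sum_congr rfl fun u _ => ?_
    split_ifs <;> ring
  rw [h3]
  ring

theorem posSemidef_weightedLaplacian (hw : ∀ e ∈ G.edgeSet, 0 < w e) :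
    (weightedLaplacian G w).PosSemidef := by
  classical
  refine PosSemidef.of_dotProduct_mulVec_nonneg ?_ fun x => ?_
  · rw [IsHermitian, conjTranspose_eq_transpose_of_trivial, weightedLaplacian_transpose]
  · rw [star_trivial, dotProduct_weightedLaplacian_mulVec]
    refine mul_nonneg (by norm_num) (Finset.sum_nonneg fun i _ => Finset.sum_nonneg fun u _ => ?_)
    split_ifs with h
    · exact mul_nonneg (hw _ h).le (sq_nonneg _)
    · exact le_rfl

/-- Cauchy–Schwarz: since `v` has sum zero, `x` may be centered first. A single mode thus bounds the
variance from below. -/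
theorem sq_dotProduct_le_populationVariance [Nonempty V] {v : V → ℝ} (hsum : ∑ i, v i = 0)
    (x : EuclideanSpace ℝ V) :
    (v ⬝ᵥ x) ^ 2 ≤ v ⬝ᵥ v * Fintype.card V * populationVariance x := by
  have hn : (Fintype.card V : ℝ) ≠ 0 := by simp
  have h1 : v ⬝ᵥ x = ∑ i, v i * (x i - (∑ j, x j) / Fintype.card V) := by
    simp only [mul_sub, Finset.sum_sub_distrib, ← Finset.sum_mul, hsum]
    simp [dotProduct]
  rw [h1, populationVariance, mul_assoc, mul_div_cancel₀ _ hn]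
  refine (Finset.sum_mul_sq_le_sq_mul_sq _ _ _).trans_eq ?_
  simp [dotProduct, sq]

end Laplacian

/-! ### Steady-state variance via a pseudoinverse, and its divergence -/

section SteadyState

variable {V : Type*} [Fintype V] [DecidableEq V] {G : SimpleGraph V} {w : Sym2 V → ℝ}

/-- The orthogonal projection onto the vectors whose entries sum to zero. -/
noncomputable def centering (V : Type*) [Fintype V] [DecidableEq V] : Matrix V V ℝ :=
  Matrix.of fun i j => (if i = j then 1 else 0) - 1 / Fintype.card V

theorem centering_mulVec_apply (x : V → ℝ) (i : V) :
    (centering V *ᵥ x) i = x i - (∑ j, x j) / Fintype.card V := by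
  simp only [mulVec, dotProduct, centering, of_apply, sub_mul, Finset.sum_sub_distrib, ite_mul,
    one_mul, zero_mul, Finset.sum_ite_eq, Finset.mem_univ, if_true, ← Finset.mul_sum]
  ring

theorem centering_transpose : (centering V)ᵀ = centering V := by
  ext i j
  simp [centering, eq_comm]

theorem centering_mul_self [Nonempty V] : centering V * centering V = centering V := by
  have hn : (Fintype.card V : ℝ) ≠ 0 := by simp
  ext i j
  rw [mul_apply_eq_vecMul, ← mulVec_transpose, centering_transpose, centering_mulVec_apply]
  simp only [centering, of_apply]
  simp [Finset.sum_sub_distrib, hn]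

theorem populationVariance_eq (x : EuclideanSpace ℝ V) :
    populationVariance x = ∑ i, (centering V i ⬝ᵥ x) ^ 2 / Fintype.card V := by
  rw [populationVariance, Finset.sum_div]
  refine Finset.sum_congr rfl fun i _ => ?_
  rw [← centering_mulVec_apply]
  rfl

theorem lintegral_populationVariance [Nonempty V] {L : Matrix V V ℝ} (hL : L.PosSemidef)
    (x₀ : V → ℝ) {t : ℝ} (ht : 0 ≤ t) :
    ∫⁻ x, ENNReal.ofReal (populationVariance x) ∂(stateLaw L x₀ t) =
      ENNReal.ofReal (((centering V * noiseCovariance L t).trace +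
        ∑ i, ((centering V * NormedSpace.exp (-t • L)) *ᵥ x₀) i ^ 2) / Fintype.card V) := by
  have hM := posSemidef_noiseCovariance hL ht
  have hn : (0 : ℝ) < Fintype.card V := by exact_mod_cast Fintype.card_pos
  have h1 : ∀ x : EuclideanSpace ℝ V, ENNReal.ofReal (populationVariance x) =
      ∑ i, ENNReal.ofReal ((centering V i ⬝ᵥ x) ^ 2) * ENNReal.ofReal (1 / Fintype.card V) := by
    intro x
    rw [populationVariance_eq, ENNReal.ofReal_sum_of_nonneg fun i _ => by positivity]
    refine Finset.sum_congr rfl fun i _ => ?_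
    rw [← ENNReal.ofReal_mul (sq_nonneg _)]
    congr 1
    ring
  have hnn : ∀ i, 0 ≤ centering V i ⬝ᵥ noiseCovariance L t *ᵥ centering V i := fun i =>
    hM.dotProduct_mulVec_nonneg (centering V i)
  simp only [h1]
  rw [lintegral_finsetSum _ (fun i _ => by
    simp only [dotProduct]
    fun_prop)]
  have h2 : ∀ i, ∫⁻ x : EuclideanSpace ℝ V, ENNReal.ofReal ((centering V i ⬝ᵥ x) ^ 2) *
      ENNReal.ofReal (1 / Fintype.card V) ∂(stateLaw L x₀ t) =
      ENNReal.ofReal ((centering V i ⬝ᵥ noiseCovariance L t *ᵥ centering V i +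
        ((centering V * NormedSpace.exp (-t • L)) *ᵥ x₀) i ^ 2) / Fintype.card V) := by
    intro i
    rw [lintegral_mul_const' _ _ ENNReal.ofReal_ne_top, stateLaw,
      lintegral_sq_dotProduct_multivariateGaussian _ hM, ← mulVec_mulVec,
      ← ENNReal.ofReal_mul (add_nonneg (hnn i) (sq_nonneg _))]
    congr 1
    rw [mul_one_div]
    rfl
  simp only [h2]
  rw [← ENNReal.ofReal_sum_of_nonneg
    fun i _ => div_nonneg (add_nonneg (hnn i) (sq_nonneg _)) hn.le, ← Finset.sum_div,
    Finset.sum_add_distrib]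
  congr 3
  -- The centering matrix is symmetric and idempotent, so one of its two copies is absorbed
  -- cyclically under the trace.
  have h3 : (centering V * noiseCovariance L t).trace =
      (centering V * noiseCovariance L t * (centering V)ᵀ).trace := by
    rw [trace_mul_comm _ (centering V)ᵀ, ← Matrix.mul_assoc, centering_transpose,
      centering_mul_self]
  rw [h3, trace]
  refine Finset.sum_congr rfl fun i _ => ?_
  rw [diag_apply, Matrix.mul_assoc, mul_apply']
  congr 1

/-- Both the covariance and the mean term reduce to `L exp(-tL) → 0` once the centering matrix is
written as `X L`. The limsup is a genuine limit. -/
theorem steadyStateVariance_eq_of_pseudoinverse [Nonempty V] (hw : ∀ e ∈ G.edgeSet, 0 < w e)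
    {X : Matrix V V ℝ} (hX : X * weightedLaplacian G w = centering V)
    (hXc : X * centering V = X) (x₀ : V → ℝ) :
    steadyStateVariance G w x₀ = ENNReal.ofReal (X.trace / 2 / Fintype.card V) := by
  set L := weightedLaplacian G w
  have hL : L.PosSemidef := posSemidef_weightedLaplacian hw
  have h0 : ∀ Y : Matrix V V ℝ,
      Tendsto (fun t : ℝ => Y * (L * NormedSpace.exp (-t • L))) atTop (𝓝 0) := by
    intro Y
    have hc : Tendsto (fun A : Matrix V V ℝ => Y * A) (𝓝 0) (𝓝 (Y * 0)) :=
      (continuous_const.matrix_mul continuous_id).tendsto 0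
    rw [Matrix.mul_zero] at hc
    exact hc.comp (tendsto_mul_exp_neg_smul hL)
  have htr : ∀ t : ℝ, (centering V * noiseCovariance L t).trace =
      2⁻¹ * (X.trace - (X * X * (L * NormedSpace.exp (-(2 * t) • L))).trace) := by
    intro t
    -- Uses `X = X C = X X L` to expose the decaying factor.
    have h1 : X * NormedSpace.exp (-(2 * t) • L) =
        X * X * (L * NormedSpace.exp (-(2 * t) • L)) := by
      rw [Matrix.mul_assoc, ← Matrix.mul_assoc X L, hX, ← Matrix.mul_assoc, hXc]
    rw [← hX, Matrix.mul_assoc, mul_noiseCovariance hL, mul_smul_comm, trace_smul,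
      Matrix.mul_sub, Matrix.mul_one, h1, trace_sub, smul_eq_mul]
  have hlim1 : Tendsto (fun t : ℝ => (centering V * noiseCovariance L t).trace) atTop
      (𝓝 (2⁻¹ * X.trace)) := by
    simp only [htr]
    have h2 : Tendsto (fun t : ℝ => 2 * t) atTop atTop :=
      tendsto_id.const_mul_atTop (by norm_num)
    have h3 : Tendsto (fun A : Matrix V V ℝ => A.trace) (𝓝 0) (𝓝 (0 : Matrix V V ℝ).trace) :=
      (continuous_id.matrix_trace).tendsto 0
    have h4 := h3.comp ((h0 (X * X)).comp h2)
    rw [trace_zero] at h4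
    simpa [Function.comp_def] using (h4.const_sub X.trace).const_mul 2⁻¹
  have hlim2 : Tendsto (fun t : ℝ =>
      ∑ i, ((centering V * NormedSpace.exp (-t • L)) *ᵥ x₀) i ^ 2) atTop (𝓝 0) := by
    have hc : Continuous fun A : Matrix V V ℝ => ∑ i, (A *ᵥ x₀) i ^ 2 := by
      have : Continuous fun A : Matrix V V ℝ => A *ᵥ x₀ :=
        continuous_id.matrix_mulVec continuous_const
      fun_prop
    have h5 := (hc.tendsto 0).comp (h0 X)
    simp only [← Matrix.mul_assoc, hX] at h5
    simpa [Function.comp_def] using h5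
  have hlim := ((hlim1.add hlim2).div_const (Fintype.card V : ℝ))
  rw [show (2⁻¹ * X.trace + 0) / (Fintype.card V : ℝ) = X.trace / 2 / Fintype.card V by ring]
    at hlim
  refine ((ENNReal.tendsto_ofReal hlim).congr' ?_).limsup_eq
  filter_upwards [eventually_ge_atTop 0] with t ht
  rw [lintegral_populationVariance hL x₀ ht]

/-- The variance of `v ⬝ᵥ x` at time `t` is `t (v ⬝ᵥ v)`, and the population variance dominates a
fixed positive multiple of `(v ⬝ᵥ x) ^ 2`. -/
theorem steadyStateVariance_eq_top [Nonempty V] (hw : ∀ e ∈ G.edgeSet, 0 < w e)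
    {v : V → ℝ} (hv : weightedLaplacian G w *ᵥ v = 0) (hv0 : v ≠ 0) (hsum : ∑ i, v i = 0)
    (x₀ : V → ℝ) : steadyStateVariance G w x₀ = ∞ := by
  set L := weightedLaplacian G w
  have hL : L.PosSemidef := posSemidef_weightedLaplacian hw
  have hn : (0 : ℝ) < Fintype.card V := by exact_mod_cast Fintype.card_pos
  have hvv : 0 < v ⬝ᵥ v := by
    have := dotProduct_star_self_pos_iff.2 hv0
    rwa [star_trivial] at this
  set c := v ⬝ᵥ v * Fintype.card V
  have hc : 0 < c := mul_pos hvv hn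
  have hlow : ∀ t : ℝ, 0 ≤ t → ENNReal.ofReal (t * (v ⬝ᵥ v / c)) ≤
      ∫⁻ x, ENNReal.ofReal (populationVariance x) ∂(stateLaw L x₀ t) := by
    intro t ht
    have h1 : ∀ x : EuclideanSpace ℝ V, ENNReal.ofReal ((v ⬝ᵥ x) ^ 2) * ENNReal.ofReal c⁻¹ ≤
        ENNReal.ofReal (populationVariance x) := by
      intro x
      rw [← ENNReal.ofReal_mul (sq_nonneg _)]
      refine ENNReal.ofReal_le_ofReal ?_
      rw [← div_eq_mul_inv, div_le_iff₀' hc]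
      exact sq_dotProduct_le_populationVariance hsum x
    refine le_trans ?_ (lintegral_mono h1)
    rw [lintegral_mul_const' _ _ ENNReal.ofReal_ne_top, stateLaw,
      lintegral_sq_dotProduct_multivariateGaussian _ (posSemidef_noiseCovariance hL ht),
      noiseCovariance_mulVec_of_ker hL hv, dotProduct_smul, smul_eq_mul,
      ← ENNReal.ofReal_mul (by positivity)]
    refine ENNReal.ofReal_le_ofReal ?_
    rw [← div_eq_mul_inv, mul_div_assoc', add_div]
    exact le_add_of_nonneg_right (div_nonneg (sq_nonneg _) hc.le)
  have hlim : Tendsto (fun t : ℝ => ENNReal.ofReal (t * (v ⬝ᵥ v / c))) atTop (𝓝 ∞) :=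
    ENNReal.tendsto_ofReal_atTop.comp (tendsto_id.atTop_mul_const (div_pos hvv hc))
  refine (tendsto_nhds_top_mono hlim ?_).limsup_eq
  filter_upwards [eventually_ge_atTop 0] with t ht using hlow t ht

end SteadyState

/-! ### Edge cuts of a tree and the pseudoinverse of its Laplacian -/

section Tree

variable {V : Type*} {G : SimpleGraph V} {w : Sym2 V → ℝ}

/-- The nodes that remain joined to `u` after the edge `uv` is removed. -/
def side (G : SimpleGraph V) (u v : V) : Set V :=
  {x | (G.deleteEdges {s(u, v)}).Reachable u x}

theorem mem_side_self (u v : V) : u ∈ side G u v := SimpleGraph.Reachable.refl _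

theorem notMem_side (hG : G.IsAcyclic) {u v : V} (h : G.Adj u v) : v ∉ side G u v :=
  SimpleGraph.isBridge_iff.1 (SimpleGraph.isAcyclic_iff_forall_adj_isBridge.1 hG h)

theorem mem_side_iff_of_adj {u v a b : V} (h : G.Adj a b) (hne : s(a, b) ≠ s(u, v)) :
    a ∈ side G u v ↔ b ∈ side G u v := by
  have hab : (G.deleteEdges {s(u, v)}).Adj a b := by
    rw [SimpleGraph.deleteEdges_adj]
    exact ⟨h, hne⟩
  exact ⟨fun h' => h'.trans hab.reachable, fun h' => h'.trans hab.symm.reachable⟩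

open Classical in
/-- The indicator function of `side G u v`. -/
noncomputable def sideIndicator (G : SimpleGraph V) (u v : V) : V → ℝ :=
  fun x => if x ∈ side G u v then 1 else 0

-- Every edge other than `uv` survives the deletion, so both its ends lie on the same side; `uv`
-- itself is a bridge. The two terms record its orientation.
open Classical in
theorem sideIndicator_sub (hG : G.IsAcyclic) {u v a b : V} (h : G.Adj u v) (hab : G.Adj a b) :
    sideIndicator G u v a - sideIndicator G u v b =
      (if u = a ∧ v = b then 1 else 0) - if u = b ∧ v = a then 1 else 0 := by
  by_cases he : s(a, b) = s(u, v)
  · rcases Sym2.eq_iff.1 he with ⟨rfl, rfl⟩ | ⟨rfl, rfl⟩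
    · have := hab.ne
      simp [sideIndicator, mem_side_self, notMem_side hG h, this]
    · have := hab.ne
      simp [sideIndicator, mem_side_self, notMem_side hG h, this, this.symm]
  · have h1 : ¬ (u = a ∧ v = b) := fun h => he (by rw [h.1, h.2])
    have h2 : ¬ (u = b ∧ v = a) := fun h => he (by rw [h.1, h.2, Sym2.eq_swap])
    rw [if_neg h1, if_neg h2]
    simp [sideIndicator, mem_side_iff_of_adj hab he]

variable [Fintype V]

/-- The number of nodes on the side of `u` after the edge `uv` is removed. -/
noncomputable def sideCard (G : SimpleGraph V) (u v : V) : ℕ := (side G u v).ncard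

theorem sum_sideIndicator (u v : V) : ∑ x, sideIndicator G u v x = sideCard G u v := by
  classical
  simp only [sideIndicator, Finset.sum_boole, sideCard]
  rw [Set.ncard_eq_toFinset_card']
  congr 2
  ext x
  simp

theorem one_le_sideCard (u v : V) : 1 ≤ sideCard G u v := by
  rw [sideCard, Nat.one_le_iff_ne_zero, ← Nat.pos_iff_ne_zero, Set.ncard_pos]
  exact ⟨u, mem_side_self u v⟩

theorem sideCard_lt (hG : G.IsAcyclic) {u v : V} (h : G.Adj u v) :
    sideCard G u v < Fintype.card V := by
  rw [← Nat.card_eq_fintype_card, ← Set.ncard_univ]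
  exact Set.ncard_lt_ncard ((Set.ssubset_univ_iff).2 fun h' =>
    notMem_side hG h (h' ▸ Set.mem_univ v))

variable [DecidableEq V]

/-- The centered indicator function of `side G u v`. -/
noncomputable def sideVector (G : SimpleGraph V) (u v : V) : V → ℝ :=
  centering V *ᵥ sideIndicator G u v

theorem sideVector_apply (u v x : V) :
    sideVector G u v x = sideIndicator G u v x - sideCard G u v / Fintype.card V := by
  rw [sideVector, centering_mulVec_apply, sum_sideIndicator]

theorem sum_sideVector [Nonempty V] (u v : V) : ∑ x, sideVector G u v x = 0 := by
  have hn : (Fintype.card V : ℝ) ≠ 0 := by simp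
  simp only [sideVector_apply, Finset.sum_sub_distrib, sum_sideIndicator]
  simp [mul_div_cancel₀, hn]

theorem sum_sq_sideVector [Nonempty V] (u v : V) : ∑ x, sideVector G u v x ^ 2 =
    sideCard G u v * (Fintype.card V - sideCard G u v) / Fintype.card V := by
  have hn : (Fintype.card V : ℝ) ≠ 0 := by simp
  have h1 : ∀ x, sideVector G u v x ^ 2 = sideIndicator G u v x -
      2 * (sideCard G u v / Fintype.card V) * sideIndicator G u v x +
      (sideCard G u v / Fintype.card V : ℝ) ^ 2 := by
    intro x
    have : sideIndicator G u v x ^ 2 = sideIndicator G u v x := by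
      simp only [sideIndicator]
      split_ifs <;> norm_num
    rw [sideVector_apply, sub_sq, this]
    ring
  simp only [h1, Finset.sum_add_distrib, Finset.sum_sub_distrib, ← Finset.mul_sum,
    sum_sideIndicator]
  simp only [Finset.sum_const, Finset.card_univ, nsmul_eq_mul]
  field_simp
  ring

open Classical in
/-- The pseudoinverse of the weighted Laplacian of a tree. -/
noncomputable def treePseudoinverse (G : SimpleGraph V) (w : Sym2 V → ℝ) : Matrix V V ℝ :=
  (2⁻¹ : ℝ) • ∑ u, ∑ v, if G.Adj u v then
    (w s(u, v))⁻¹ • vecMulVec (sideVector G u v) (sideVector G u v) else 0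

theorem treePseudoinverse_transpose : (treePseudoinverse G w)ᵀ = treePseudoinverse G w := by
  simp only [treePseudoinverse, transpose_smul, transpose_sum]
  refine congrArg _ (Finset.sum_congr rfl fun u _ => Finset.sum_congr rfl fun v _ => ?_)
  split_ifs <;> simp

-- The vector varies only across the edge `uv`, so only the flow through that edge remains;
-- centering does not affect differences.
open Classical in
theorem weightedLaplacian_mulVec_sideVector (hG : G.IsAcyclic) {u v : V} (h : G.Adj u v)
    (i : V) : (weightedLaplacian G w *ᵥ sideVector G u v) i =
      w s(u, v) * ((if u = i then 1 else 0) - if v = i then 1 else 0) := by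
  rw [weightedLaplacian_mulVec_apply]
  have h1 : ∀ b, (if G.Adj i b then w s(i, b) * (sideVector G u v i - sideVector G u v b) else 0)
      = (if v = b then if u = i then w s(u, v) else 0 else 0) -
        if u = b then if v = i then w s(u, v) else 0 else 0 := by
    intro b
    by_cases hib : G.Adj i b
    · rw [if_pos hib, sideVector_apply, sideVector_apply, sub_sub_sub_cancel_right,
        sideIndicator_sub hG h hib]
      have := h.ne
      by_cases h1 : u = i <;> by_cases h2 : v = b <;> by_cases h3 : u = b <;>
        by_cases h4 : v = i <;> simp_all [Sym2.eq_swap]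
    · rw [if_neg hib]
      have h2 : ¬ (v = b ∧ u = i) := fun h' => hib (h'.1 ▸ h'.2 ▸ h)
      have h3 : ¬ (u = b ∧ v = i) := fun h' => hib (h'.1 ▸ h'.2 ▸ h.symm)
      rw [← ite_and, ← ite_and, if_neg h2, if_neg h3, sub_zero]
  simp only [h1, Finset.sum_sub_distrib, Finset.sum_ite_eq, Finset.mem_univ, if_true]
  split_ifs <;> ring

theorem weightedLaplacian_mul_treePseudoinverse (hG : G.IsTree)
    (hw : ∀ e ∈ G.edgeSet, 0 < w e) :
    weightedLaplacian G w * treePseudoinverse G w = centering V := by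
  classical
  have := hG.connected.nonempty
  have hn : (Fintype.card V : ℝ) ≠ 0 := by simp
  have h1 : ∀ i j, (weightedLaplacian G w * treePseudoinverse G w) i j =
      2⁻¹ * ∑ u, ∑ v, if G.Adj u v then
        ((if u = i then 1 else 0) - if v = i then 1 else 0) * sideVector G u v j else 0 := by
    intro i j
    simp only [treePseudoinverse, mul_smul_comm, Matrix.mul_sum, Matrix.smul_apply,
      Matrix.sum_apply, smul_eq_mul]
    refine congrArg _ (Finset.sum_congr rfl fun u _ => Finset.sum_congr rfl fun v _ => ?_)
    by_cases h : G.Adj u v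
    · rw [if_pos h, if_pos h, mul_smul_comm, mul_vecMulVec, Matrix.smul_apply, vecMulVec_apply,
        weightedLaplacian_mulVec_sideVector hG.isAcyclic h, smul_eq_mul]
      have := (hw s(u, v) h).ne'
      rw [← mul_assoc, ← mul_assoc, inv_mul_cancel₀ this, one_mul]
    · rw [if_neg h, if_neg h, Matrix.mul_zero, Matrix.zero_apply]
  ext i j
  -- Row `i` of the product minus the identity has no jump across any edge, so it is constant by
  -- connectedness. Its sum is `-1`, so the constant is `-1/n`.
  set F : V → ℝ := fun j => (weightedLaplacian G w * treePseudoinverse G w) i j -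
    if i = j then 1 else 0 with hF
  have hadj : ∀ a b, G.Adj a b → F a = F b := by
    intro a b hab
    have h2 : ∀ u v, (if G.Adj u v then
        ((if u = i then 1 else 0) - if v = i then 1 else 0) * sideVector G u v a else 0) -
        (if G.Adj u v then
        ((if u = i then 1 else 0) - if v = i then 1 else 0) * sideVector G u v b else (0 : ℝ)) =
        (if v = b then if u = a then
          ((if u = i then 1 else 0) - if v = i then 1 else 0) else 0 else 0) -
        (if v = a then if u = b then
          ((if u = i then 1 else 0) - if v = i then 1 else 0) else 0 else 0) := by
      intro u v
      by_cases h : G.Adj u v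
      · rw [if_pos h, if_pos h, ← mul_sub, sideVector_apply, sideVector_apply,
          sub_sub_sub_cancel_right, sideIndicator_sub hG.isAcyclic h hab, mul_sub]
        simp only [mul_ite, mul_one, mul_zero, ite_and]
        congr 1 <;> grind
      · have h2 : ¬ (v = b ∧ u = a) := fun h' => h (h'.1 ▸ h'.2 ▸ hab)
        have h3 : ¬ (v = a ∧ u = b) := fun h' => h (h'.1 ▸ h'.2 ▸ hab.symm)
        rw [← ite_and, ← ite_and, if_neg h2, if_neg h3, if_neg h, if_neg h]
    have h3 : (weightedLaplacian G w * treePseudoinverse G w) i a -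
        (weightedLaplacian G w * treePseudoinverse G w) i b =
        (if i = a then 1 else 0) - if i = b then 1 else 0 := by
      rw [h1, h1, ← mul_sub]
      simp only [← Finset.sum_sub_distrib, h2]
      simp only [Finset.sum_sub_distrib, Finset.sum_ite_eq', Finset.mem_univ, if_true,
        eq_comm (b := i)]
      ring
    simp only [hF]
    linarith
  have hconst : ∀ a b, F a = F b := by
    intro a b
    obtain ⟨p⟩ := hG.connected.preconnected a b
    induction p with
    | nil => rfl
    | cons h _ ih => exact (hadj _ _ h).trans ih
  have hsum : ∑ j, F j = -1 := by
    simp only [hF, Finset.sum_sub_distrib, h1, ← Finset.mul_sum]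
    have h2 : ∑ j, ∑ u, ∑ v, (if G.Adj u v then
        ((if u = i then 1 else 0) - if v = i then 1 else 0) * sideVector G u v j
        else (0 : ℝ)) = 0 := by
      rw [Finset.sum_comm]
      refine Finset.sum_eq_zero fun u _ => ?_
      rw [Finset.sum_comm]
      refine Finset.sum_eq_zero fun v _ => ?_
      by_cases h : G.Adj u v
      · simp only [if_pos h]
        rw [← Finset.mul_sum, sum_sideVector, mul_zero]
      · simp only [if_neg h, Finset.sum_const_zero]
    rw [h2]
    simp
  have hFj : F j = -(1 / Fintype.card V) := by
    simp only [fun a => hconst a j, Finset.sum_const, Finset.card_univ, nsmul_eq_mul] at hsum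
    field_simp
    linarith
  simp only [hF] at hFj
  simp only [centering, of_apply]
  linarith

theorem treePseudoinverse_mul_centering [Nonempty V] :
    treePseudoinverse G w * centering V = treePseudoinverse G w := by
  simp only [treePseudoinverse, smul_mul_assoc, Matrix.sum_mul]
  refine congrArg _ (Finset.sum_congr rfl fun u _ => Finset.sum_congr rfl fun v _ => ?_)
  split_ifs
  · rw [smul_mul_assoc, vecMulVec_mul, ← mulVec_transpose, centering_transpose, sideVector,
      mulVec_mulVec, centering_mul_self]
  · simp

open Classical in
theorem trace_treePseudoinverse [Nonempty V] : (treePseudoinverse G w).trace =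
    2⁻¹ * ∑ u, ∑ v, if G.Adj u v then (w s(u, v))⁻¹ *
      (sideCard G u v * (Fintype.card V - sideCard G u v) / Fintype.card V) else 0 := by
  simp only [treePseudoinverse, trace_smul, trace_sum, smul_eq_mul]
  congr! 5 with u _ v _
  split_ifs
  · rw [trace_smul, trace_vecMulVec, smul_eq_mul, ← sum_sq_sideVector]
    simp only [dotProduct, sq]
  · simp

open Classical in
/-- The structural variance of a tree. -/
noncomputable def treeVariance (G : SimpleGraph V) : ℝ :=
  2⁻¹ * (∑ u, ∑ v, if G.Adj u v then
      (sideCard G u v * (Fintype.card V - sideCard G u v) / Fintype.card V : ℝ) else 0) / 2 /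
    Fintype.card V

theorem steadyStateVariance_of_isTree (hG : G.IsTree) (hw : ∀ e ∈ G.edgeSet, 0 < w e)
    (x₀ : V → ℝ) : steadyStateVariance G w x₀ =
      ENNReal.ofReal ((treePseudoinverse G w).trace / 2 / Fintype.card V) := by
  have := hG.connected.nonempty
  refine steadyStateVariance_eq_of_pseudoinverse hw ?_ treePseudoinverse_mul_centering x₀
  rw [← centering_transpose, ← weightedLaplacian_mul_treePseudoinverse hG hw, transpose_mul,
    treePseudoinverse_transpose, weightedLaplacian_transpose]

/-- The trace is nonincreasing in each weight, so the infimum is attained at unit weights. -/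
theorem structuralVariance_of_isTree (hG : G.IsTree) (x₀ : V → ℝ) :
    structuralVariance G x₀ = ENNReal.ofReal (treeVariance G) := by
  classical
  have := hG.connected.nonempty
  refine le_antisymm ?_ (le_iInf₂ fun w hw => ?_)
  · refine (iInf₂_le (fun _ => 1) fun _ _ => ⟨one_pos, le_rfl⟩).trans_eq ?_
    rw [steadyStateVariance_of_isTree hG fun _ _ => one_pos, trace_treePseudoinverse,
      treeVariance]
    simp only [inv_one, one_mul]
  · rw [steadyStateVariance_of_isTree hG fun e he => (hw e he).1, trace_treePseudoinverse,
      treeVariance]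
    refine ENNReal.ofReal_le_ofReal ?_
    gcongr with u _ v _
    split_ifs with h
    · have h1 : (sideCard G u v : ℝ) ≤ Fintype.card V := by
        exact_mod_cast (sideCard_lt hG.isAcyclic h).le
      have h2 := hw s(u, v) h
      refine le_mul_of_one_le_left ?_ ((one_le_inv₀ h2.1).2 h2.2)
      exact div_nonneg (mul_nonneg (Nat.cast_nonneg _) (sub_nonneg.2 h1)) (Nat.cast_nonneg _)
    · exact le_rfl

end Tree

/-! ### Stars as the extremal trees; disconnected graphs -/

section Extremal

variable {V : Type*} {G : SimpleGraph V}

theorem eq_of_adj_of_side_eq_singleton {u v x : V}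
    (h : side G u v = {u}) (hx : G.Adj u x) : x = v := by
  by_contra hne
  have he : s(u, x) ≠ s(u, v) := fun h' => hne (Sym2.congr_right.1 h')
  have hmem : x ∈ side G u v := (mem_side_iff_of_adj hx he).1 (mem_side_self u v)
  rw [h] at hmem
  exact hx.ne' hmem

theorem eq_of_adj_of_compl_side_eq_singleton (hG : G.IsAcyclic) {u v x : V}
    (huv : G.Adj u v) (h : (side G u v)ᶜ = {v}) (hx : G.Adj v x) : x = u := by
  by_contra hne
  have he : s(v, x) ≠ s(u, v) := by
    rw [Sym2.eq_swap (a := u)]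
    exact fun h' => hne (Sym2.congr_right.1 h')
  have hmem : x ∈ (side G u v)ᶜ :=
    fun h' => notMem_side hG huv ((mem_side_iff_of_adj hx he).2 h')
  rw [h] at hmem
  exact hx.ne' hmem

/-- Having two neighbours, `h` is not a leaf, so all its neighbours are. A walk to `h` can then
never start farther away than a neighbour. -/
theorem eq_starGraph_of_leaf_edges (hG : G.Connected) {h a b : V} (ha : G.Adj h a)
    (hb : G.Adj h b) (hab : a ≠ b)
    (hleaf : ∀ u v, G.Adj u v → (∀ x, G.Adj u x → x = v) ∨ ∀ x, G.Adj v x → x = u) :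
    G = SimpleGraph.starGraph h := by
  have hnbr : ∀ v, G.Adj h v → ∀ x, G.Adj v x → x = h := by
    intro v hv
    rcases hleaf h v hv with h1 | h1
    · exact absurd ((h1 a ha).trans (h1 b hb).symm) hab
    · exact h1
  have hall : ∀ x, x = h ∨ G.Adj h x := by
    intro x
    obtain ⟨p⟩ := hG.preconnected x h
    induction p with
    | nil => exact Or.inl rfl
    | cons hadj _ ih =>
      rcases ih ha hb hnbr with rfl | h1
      · exact Or.inr hadj.symm
      · exact Or.inl (hnbr _ h1 _ hadj.symm)
  ext x y
  rw [SimpleGraph.starGraph_adj]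
  constructor
  · intro hxy
    refine ⟨hxy.ne, ?_⟩
    rcases hall x with rfl | hx
    · exact Or.inl rfl
    · exact Or.inr (hnbr x hx y hxy)
  · rintro ⟨hne, rfl | rfl⟩
    · exact (hall y).resolve_left hne.symm
    · exact ((hall x).resolve_left hne).symm

variable [Fintype V]

theorem exists_eq_starGraph (hn : 3 ≤ Fintype.card V) (hG : G.IsTree)
    (h : ∀ u v, G.Adj u v → sideCard G u v = 1 ∨ sideCard G u v + 1 = Fintype.card V) :
    ∃ c, G = SimpleGraph.starGraph c := by
  classical
  -- Otherwise the degree sum `2(n - 1)` would be at most `n`, contradicting `n ≥ 3`.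
  have hdeg : ∃ c, 1 < G.degree c := by
    by_contra! hle
    have h1 := G.sum_degrees_eq_twice_card_edges
    have h2 := hG.card_edgeFinset
    have h3 : ∑ v, G.degree v ≤ ∑ _v : V, 1 := Finset.sum_le_sum fun v _ => hle v
    simp only [Finset.sum_const, Finset.card_univ, smul_eq_mul, mul_one] at h3
    omega
  obtain ⟨c, hc⟩ := hdeg
  rw [← SimpleGraph.card_neighborFinset_eq_degree, Finset.one_lt_card] at hc
  obtain ⟨a, ha, b, hb, hab⟩ := hc
  rw [SimpleGraph.mem_neighborFinset] at ha hb
  refine ⟨c, eq_starGraph_of_leaf_edges hG.connected ha hb hab fun u v huv => ?_⟩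
  rcases h u v huv with h1 | h1
  · obtain ⟨y, hy⟩ := Set.ncard_eq_one.1 h1
    have hu : u ∈ side G u v := mem_side_self u v
    have : y = u := by rw [hy] at hu; exact hu.symm
    exact Or.inl fun x hx => eq_of_adj_of_side_eq_singleton (this ▸ hy) hx
  · have h2 := Set.ncard_add_ncard_compl (side G u v)
    rw [Nat.card_eq_fintype_card] at h2
    have h3 : (side G u v)ᶜ.ncard = 1 := by
      rw [sideCard] at h1
      omega
    obtain ⟨y, hy⟩ := Set.ncard_eq_one.1 h3
    have hv : v ∈ (side G u v)ᶜ := notMem_side hG.isAcyclic huv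
    have : y = v := by rw [hy] at hv; exact hv.symm
    exact Or.inr fun x hx =>
      eq_of_adj_of_compl_side_eq_singleton hG.isAcyclic huv (this ▸ hy) hx

theorem sideCard_starGraph {c u v : V} (h : (SimpleGraph.starGraph c).Adj u v) :
    sideCard (SimpleGraph.starGraph c) u v = 1 ∨
      sideCard (SimpleGraph.starGraph c) u v + 1 = Fintype.card V := by
  have hac := SimpleGraph.isAcyclic_starGraph c
  obtain ⟨hne, rfl | rfl⟩ := SimpleGraph.starGraph_adj.1 h
  · right
    have h1 : (side (SimpleGraph.starGraph u) u v)ᶜ = {v} := by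
      ext x
      simp only [Set.mem_compl_iff, Set.mem_singleton_iff]
      constructor
      · intro hx
        by_contra hxv
        apply hx
        by_cases hxu : x = u
        · rw [hxu]; exact mem_side_self u v
        · refine (mem_side_iff_of_adj (a := u) (b := x) ?_ ?_).1 (mem_side_self u v)
          · exact SimpleGraph.starGraph_center_adj (Ne.symm hxu)
          · exact fun h' => hxv (Sym2.congr_right.1 h')
      · rintro rfl
        exact notMem_side hac h
    have h2 := Set.ncard_add_ncard_compl (side (SimpleGraph.starGraph u) u v)
    rwa [h1, Set.ncard_singleton, Nat.card_eq_fintype_card] at h2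
  · left
    have h1 : side (SimpleGraph.starGraph v) u v = {u} := by
      ext x
      simp only [Set.mem_singleton_iff]
      constructor
      · intro hx
        by_contra hxu
        by_cases hxv : x = v
        · exact notMem_side hac h (hxv ▸ hx)
        · refine notMem_side hac h ((mem_side_iff_of_adj (a := x) (b := v) ?_ ?_).1 hx)
          · exact (SimpleGraph.starGraph_center_adj (Ne.symm hxv)).symm
          · exact fun h' => hxu (Sym2.congr_left.1 h')
      · rintro rfl
        exact mem_side_self _ _
    rw [sideCard, h1, Set.ncard_singleton]

/-- The structural variance of a star graph on `n` nodes. -/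
noncomputable def starVariance (n : ℕ) : ℝ :=
  2⁻¹ * (2 * (n - 1) * ((n - 1) / n)) / 2 / n

theorem starVariance_nonneg (n : ℕ) : 0 ≤ starVariance n := by
  have h : starVariance n = ((n : ℝ) - 1) ^ 2 / n / 2 / n := by
    rw [starVariance]
    ring
  rw [h]
  positivity

-- Splits `s(n - s)` as `(n - 1) + (s - 1)(n - 1 - s)`. The `n - 1` edges, each seen in both
-- orientations, make the first part the cost of a star.
open Classical in
theorem treeVariance_eq (hG : G.IsTree) : treeVariance G = starVariance (Fintype.card V) +
    2⁻¹ * (∑ u, ∑ v, if G.Adj u v then ((sideCard G u v - 1) *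
      (Fintype.card V - 1 - sideCard G u v) / Fintype.card V : ℝ) else 0) / 2 /
        Fintype.card V := by
  have h1 := G.sum_degrees_eq_twice_card_edges
  have h2 := hG.card_edgeFinset
  have h3 : ∑ u, ∑ v, (if G.Adj u v then ((Fintype.card V - 1) / Fintype.card V : ℝ) else 0) =
      2 * (Fintype.card V - 1) * ((Fintype.card V - 1) / Fintype.card V) := by
    have h4 : ∀ u, ∑ v, (if G.Adj u v then ((Fintype.card V - 1) / Fintype.card V : ℝ) else 0) =
        G.degree u * ((Fintype.card V - 1) / Fintype.card V) := by
      intro u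
      rw [← Finset.sum_filter, Finset.sum_const, nsmul_eq_mul,
        ← SimpleGraph.card_neighborFinset_eq_degree, SimpleGraph.neighborFinset_eq_filter]
    simp only [h4]
    rw [← Finset.sum_mul, ← Nat.cast_sum, h1, ← h2]
    push_cast
    ring
  rw [treeVariance, starVariance, ← h3, ← add_div, ← add_div, ← mul_add,
    ← Finset.sum_add_distrib]
  simp only [← Finset.sum_add_distrib]
  refine congrArg (fun s : ℝ => 2⁻¹ * s / 2 / Fintype.card V) ?_
  refine Finset.sum_congr rfl fun u _ => Finset.sum_congr rfl fun v _ => ?_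
  split_ifs <;> ring

open Classical in
theorem excess_nonneg (hG : G.IsTree) (u v : V) : (0 : ℝ) ≤ if G.Adj u v then
    ((sideCard G u v - 1) * (Fintype.card V - 1 - sideCard G u v) / Fintype.card V : ℝ)
      else 0 := by
  split_ifs with h
  · have h1 : (1 : ℝ) ≤ sideCard G u v := by exact_mod_cast one_le_sideCard u v
    have h2 : (sideCard G u v : ℝ) + 1 ≤ Fintype.card V := by
      exact_mod_cast sideCard_lt hG.isAcyclic h
    exact div_nonneg (mul_nonneg (by linarith) (by linarith)) (Nat.cast_nonneg _)
  · exact le_rfl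

theorem starVariance_le_treeVariance (hG : G.IsTree) :
    starVariance (Fintype.card V) ≤ treeVariance G := by
  classical
  rw [treeVariance_eq hG]
  have := Finset.sum_nonneg fun u (_ : u ∈ Finset.univ) =>
    Finset.sum_nonneg fun v (_ : v ∈ Finset.univ) => excess_nonneg hG u v
  exact le_add_of_nonneg_right (by positivity)

theorem treeVariance_starGraph (c : V) :
    treeVariance (SimpleGraph.starGraph c) = starVariance (Fintype.card V) := by
  classical
  rw [treeVariance_eq (SimpleGraph.isTree_starGraph c),
    Finset.sum_eq_zero]
  · simp
  · intro u _
    refine Finset.sum_eq_zero fun v _ => ?_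
    split_ifs with h
    · rcases sideCard_starGraph h with h1 | h1
      · simp [h1]
      · simp [← h1]
    · rfl

theorem exists_eq_starGraph_of_treeVariance_le (hn : 3 ≤ Fintype.card V) (hG : G.IsTree)
    (h : treeVariance G ≤ starVariance (Fintype.card V)) :
    ∃ c, G = SimpleGraph.starGraph c := by
  classical
  have hn0 : (0 : ℝ) < Fintype.card V := by
    have : 0 < Fintype.card V := by omega
    exact_mod_cast this
  refine exists_eq_starGraph hn hG fun u v huv => ?_
  rw [treeVariance_eq hG] at h
  have h0 := Finset.sum_nonneg fun u (_ : u ∈ Finset.univ) =>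
    Finset.sum_nonneg fun v (_ : v ∈ Finset.univ) => excess_nonneg hG u v
  set S := ∑ u, ∑ v, if G.Adj u v then
    ((sideCard G u v - 1) * (Fintype.card V - 1 - sideCard G u v) / Fintype.card V : ℝ)
      else 0 with hS
  have h1 : S = 0 := by
    refine le_antisymm ?_ h0
    by_contra! hpos
    have : 0 < 2⁻¹ * S / 2 / Fintype.card V := by positivity
    linarith
  rw [hS, Finset.sum_eq_zero_iff_of_nonneg fun u _ =>
    Finset.sum_nonneg fun v _ => excess_nonneg hG u v] at h1
  have h2 := h1 u (Finset.mem_univ _)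
  rw [Finset.sum_eq_zero_iff_of_nonneg fun v _ => excess_nonneg hG u v] at h2
  have h3 := h2 v (Finset.mem_univ _)
  rw [if_pos huv, div_eq_zero_iff, mul_eq_zero] at h3
  rcases h3 with (h3 | h3) | h3
  · left
    exact_mod_cast sub_eq_zero.1 h3
  · right
    have : (sideCard G u v : ℝ) + 1 = Fintype.card V := by linarith
    exact_mod_cast this
  · exact absurd h3 hn0.ne'

variable [DecidableEq V]

theorem structuralVariance_of_not_connected [Nonempty V] (hG : ¬ G.Connected) (x₀ : V → ℝ) :
    structuralVariance G x₀ = ∞ := by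
  classical
  have hpre : ¬ G.Preconnected := fun h => hG ⟨h⟩
  simp only [SimpleGraph.Preconnected, not_forall] at hpre
  obtain ⟨a, b, hab⟩ := hpre
  -- The centered indicator of a component lies in the kernel for every choice of weights.
  set χ : V → ℝ := fun x => if G.Reachable a x then 1 else 0 with hχ
  have hχadj : ∀ x y, G.Adj x y → χ x = χ y := by
    intro x y hxy
    have : G.Reachable a x ↔ G.Reachable a y :=
      ⟨fun h => h.trans hxy.reachable, fun h => h.trans hxy.symm.reachable⟩
    simp only [hχ, this]
  have hn : (Fintype.card V : ℝ) ≠ 0 := by simp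
  rw [structuralVariance, iInf₂_eq_top]
  intro w hw
  refine steadyStateVariance_eq_top (v := centering V *ᵥ χ) (fun e he => (hw e he).1) ?_ ?_ ?_ x₀
  · ext i
    rw [weightedLaplacian_mulVec_apply]
    refine Finset.sum_eq_zero fun u _ => ?_
    split_ifs with h
    · rw [centering_mulVec_apply, centering_mulVec_apply, hχadj i u h, sub_self, mul_zero]
    · rfl
  · intro h0
    have h1 := congrFun h0 a
    have h2 := congrFun h0 b
    rw [centering_mulVec_apply, Pi.zero_apply] at h1 h2
    have h3 : χ a = 1 := if_pos (SimpleGraph.Reachable.refl a)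
    have h4 : χ b = 0 := if_neg hab
    linarith
  · simp only [centering_mulVec_apply, Finset.sum_sub_distrib]
    simp [mul_div_cancel₀, hn]

end Extremal

/-! ### Capacity counting and the distribution of hubs -/

section Assignment

variable {V : Type*} {α k : ℕ}

theorem ncard_setOf_mem_edgeSet_starGraph (hub : Fin k → V) {u v : V} (huv : u ≠ v) :
    {l | s(u, v) ∈ (SimpleGraph.starGraph (hub l)).edgeSet}.ncard =
      {l | hub l = u}.ncard + {l | hub l = v}.ncard := by
  rw [← Set.ncard_union_eq]
  · congr 1
    ext l
    simp only [SimpleGraph.mem_edgeSet, SimpleGraph.starGraph_adj, Set.mem_ofPred_eq,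
      Set.mem_union, huv, ne_eq, not_false_eq_true, true_and, eq_comm]
  · rw [Set.disjoint_left]
    intro l hu hv
    exact huv (hu.symm.trans hv)

theorem exists_perm_of_ncard_fiber_eq {hub hub' : Fin k → V}
    (h : ∀ v, {l | hub l = v}.ncard = {l | hub' l = v}.ncard) :
    ∃ σ : Equiv.Perm (Fin k), ∀ l, hub' l = hub (σ l) := by
  have e : ∀ v, {l // hub' l = v} ≃ {l // hub l = v} := fun v =>
    Classical.choice (Finite.card_eq.1 (h v).symm)
  exact ⟨Equiv.ofFiberEquiv e, fun l => (Equiv.ofFiberEquiv_map e l).symm⟩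

theorem isFeasible_starGraph {hub : Fin k → V} (h : ∀ v, {l | hub l = v}.ncard = α) :
    IsFeasible (⊤ : SimpleGraph V) (fun _ => 2 * α) fun l => SimpleGraph.starGraph (hub l) := by
  refine ⟨fun _ => le_top, fun e => ?_⟩
  induction e with
  | _ u v =>
    intro he
    rw [ncard_setOf_mem_edgeSet_starGraph hub he, h, h, two_mul]

variable [Fintype V]

/-- Double counting of pairs (edge, dimension) against the total capacity. -/
theorem sum_card_edgeSet_le {H : Fin k → SimpleGraph V} (hk : k = α * Fintype.card V)
    (hH : IsFeasible (⊤ : SimpleGraph V) (fun _ => 2 * α) H) :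
    ∑ l, Nat.card (H l).edgeSet ≤ ∑ _l : Fin k, (Fintype.card V - 1) := by
  classical
  have h1 : ∀ l, Nat.card (H l).edgeSet =
      ∑ e ∈ (⊤ : SimpleGraph V).edgeFinset, if e ∈ (H l).edgeSet then 1 else 0 := by
    intro l
    rw [Nat.card_eq_fintype_card, ← SimpleGraph.edgeFinset_card, Finset.sum_boole, Nat.cast_id]
    congr 1
    ext e
    rw [Finset.mem_filter, SimpleGraph.mem_edgeFinset, SimpleGraph.mem_edgeFinset]
    exact ⟨fun h => ⟨SimpleGraph.edgeSet_mono (hH.1 l) h, h⟩, fun h => h.2⟩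
  simp only [h1]
  rw [Finset.sum_comm]
  have h2 : ∀ e ∈ (⊤ : SimpleGraph V).edgeFinset,
      ∑ l, (if e ∈ (H l).edgeSet then 1 else 0) ≤ 2 * α := by
    intro e he
    have := hH.2 e (SimpleGraph.mem_edgeFinset.1 he)
    rw [Set.ncard_eq_toFinset_card'] at this
    rw [Finset.sum_boole, Nat.cast_id]
    convert this using 2
    ext l
    simp
  refine (Finset.sum_le_card_nsmul _ _ _ h2).trans_eq ?_
  rw [SimpleGraph.card_edgeFinset_top_eq_card_choose_two, Finset.sum_const, Finset.card_univ,
    Fintype.card_fin, smul_eq_mul, smul_eq_mul, hk]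
  have h3 := Nat.div_mul_cancel (Nat.even_mul_pred_self (Fintype.card V)).two_dvd
  rw [← Nat.choose_two_right] at h3
  calc _ = α * ((Fintype.card V).choose 2 * 2) := by ring
    _ = _ := by rw [h3]; ring

/-- Each connected graph needs `n - 1` edges and the capacity allows only that many on average, so
equality holds in every dimension. -/
theorem isTree_of_isFeasible {H : Fin k → SimpleGraph V} (hk : k = α * Fintype.card V)
    (hH : IsFeasible (⊤ : SimpleGraph V) (fun _ => 2 * α) H) (hc : ∀ l, (H l).Connected)
    (l : Fin k) : (H l).IsTree := by
  have h1 : ∀ l, Fintype.card V - 1 ≤ Nat.card (H l).edgeSet := by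
    intro l
    have := (hc l).card_vert_le_card_edgeSet_add_one
    rw [Nat.card_eq_fintype_card] at this
    omega
  have h2 := (Finset.sum_eq_sum_iff_of_le fun l _ => h1 l).1
    (le_antisymm (Finset.sum_le_sum fun l _ => h1 l) (sum_card_edgeSet_le hk hH)) l
    (Finset.mem_univ l)
  have := (hc l).nonempty
  have h3 : 0 < Fintype.card V := Fintype.card_pos
  rw [SimpleGraph.isTree_iff_connected_and_card, Nat.card_eq_fintype_card (α := V)]
  exact ⟨hc l, by omega⟩

theorem sum_ncard_fiber (hub : Fin k → V) : ∑ v, {l | hub l = v}.ncard = k := by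
  classical
  have := Finset.card_eq_sum_card_fiberwise (f := hub) (s := Finset.univ) (t := Finset.univ)
    (fun _ _ => Finset.mem_coe.2 (Finset.mem_univ _))
  rw [Finset.card_univ, Fintype.card_fin] at this
  refine Eq.trans (Finset.sum_congr rfl fun v _ => ?_) this.symm
  rw [Set.ncard_eq_toFinset_card']
  congr 1
  ext l
  simp

theorem ncard_fiber_eq (hn : 3 ≤ Fintype.card V) (hk : k = α * Fintype.card V) {hub : Fin k → V}
    (h : IsFeasible (⊤ : SimpleGraph V) (fun _ => 2 * α)
      fun l => SimpleGraph.starGraph (hub l)) (v : V) : {l | hub l = v}.ncard = α := by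
  classical
  set a : V → ℕ := fun v => {l | hub l = v}.ncard with ha
  have hsum : ∑ v, a v = α * Fintype.card V := (sum_ncard_fiber hub).trans hk
  have hpair : ∀ u v, u ≠ v → a u + a v ≤ 2 * α := by
    intro u v huv
    have := h.2 s(u, v) huv
    rwa [ncard_setOf_mem_edgeSet_starGraph hub huv] at this
  -- Summing `hpair` over all `v ≠ u` gives `(n - 2) a u ≤ (n - 2) α`; here `n ≥ 3` allows the
  -- cancellation.
  have hle : ∀ u, a u ≤ α := by
    intro u
    have h1 : ∑ v ∈ Finset.univ.erase u, (a u + a v) ≤ ∑ _v ∈ Finset.univ.erase u, 2 * α :=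
      Finset.sum_le_sum fun v hv => hpair u v (Finset.ne_of_mem_erase hv).symm
    have h2 := Finset.add_sum_erase Finset.univ a (Finset.mem_univ u)
    rw [Finset.sum_add_distrib, Finset.sum_const, Finset.sum_const,
      Finset.card_erase_of_mem (Finset.mem_univ u), Finset.card_univ, smul_eq_mul,
      smul_eq_mul] at h1
    obtain ⟨m, hm⟩ : ∃ m, Fintype.card V = m + 3 := ⟨_, (Nat.sub_add_cancel hn).symm⟩
    rw [hm] at h1 hsum
    rw [hsum] at h2
    simp only [Nat.add_succ_sub_one] at h1
    nlinarith
  have heq := (Finset.sum_eq_sum_iff_of_le fun u (_ : u ∈ Finset.univ) => hle u).1 (by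
    rw [hsum, Finset.sum_const, Finset.card_univ, smul_eq_mul, mul_comm])
  exact heq v (Finset.mem_univ v)

theorem exists_hub (hk : k = α * Fintype.card V) :
    ∃ hub : Fin k → V, ∀ v, {l | hub l = v}.ncard = α := by
  classical
  -- The dimensions are indexed by a hub and one of its `α` copies.
  have e : Fin k ≃ V × Fin α := Fintype.equivOfCardEq (by simp [hk, mul_comm])
  refine ⟨fun l => (e l).1, fun v => ?_⟩
  have h1 : {l | (e l).1 = v} = (fun j => e.symm (v, j)) '' Set.univ := by
    ext l
    simp only [Set.mem_ofPred_eq, Set.image_univ, Set.mem_range]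
    constructor
    · rintro rfl
      exact ⟨(e l).2, by simp⟩
    · rintro ⟨j, rfl⟩
      simp
  rw [h1, Set.ncard_image_of_injective, Set.ncard_univ, Nat.card_fin]
  intro i j hij
  simpa using hij

variable [DecidableEq V]

theorem totalCost_of_isTree (x₀ : Fin k → V → ℝ) {H : Fin k → SimpleGraph V}
    (hH : ∀ l, (H l).IsTree) : totalCost x₀ H = ENNReal.ofReal (∑ l, treeVariance (H l)) := by
  rw [ENNReal.ofReal_sum_of_nonneg fun l _ =>
    (starVariance_nonneg _).trans (starVariance_le_treeVariance (hH l))]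
  exact Finset.sum_congr rfl fun l _ => structuralVariance_of_isTree (hH l) _

theorem totalCost_starGraph (x₀ : Fin k → V → ℝ) (hub : Fin k → V) :
    totalCost x₀ (fun l => SimpleGraph.starGraph (hub l)) =
      ENNReal.ofReal (∑ _l : Fin k, starVariance (Fintype.card V)) := by
  rw [totalCost_of_isTree x₀ fun l => SimpleGraph.isTree_starGraph (hub l)]
  simp only [treeVariance_starGraph]

theorem isTree_or_totalCost_eq_top [Nonempty V] (hk : k = α * Fintype.card V)
    (x₀ : Fin k → V → ℝ) {H : Fin k → SimpleGraph V}
    (hH : IsFeasible (⊤ : SimpleGraph V) (fun _ => 2 * α) H) :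
    (∀ l, (H l).IsTree) ∨ totalCost x₀ H = ∞ := by
  by_cases hc : ∀ l, (H l).Connected
  · exact Or.inl (isTree_of_isFeasible hk hH hc)
  · right
    push Not at hc
    obtain ⟨l, hl⟩ := hc
    exact ENNReal.sum_eq_top.2
      ⟨l, Finset.mem_univ l, structuralVariance_of_not_connected hl (x₀ l)⟩

theorem le_totalCost [Nonempty V] (hk : k = α * Fintype.card V)
    (x₀ : Fin k → V → ℝ) {H : Fin k → SimpleGraph V}
    (hH : IsFeasible (⊤ : SimpleGraph V) (fun _ => 2 * α) H) :
    ENNReal.ofReal (∑ _l : Fin k, starVariance (Fintype.card V)) ≤ totalCost x₀ H := by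
  rcases isTree_or_totalCost_eq_top hk x₀ hH with h | h
  · rw [totalCost_of_isTree x₀ h]
    exact ENNReal.ofReal_le_ofReal
      (Finset.sum_le_sum fun l _ => starVariance_le_treeVariance (h l))
  · rw [h]
    exact le_top

theorem exists_eq_starGraph_of_totalCost_le (hn : 3 ≤ Fintype.card V)
    (hk : k = α * Fintype.card V) (x₀ : Fin k → V → ℝ) {H : Fin k → SimpleGraph V}
    (hH : IsFeasible (⊤ : SimpleGraph V) (fun _ => 2 * α) H)
    (hcost : totalCost x₀ H ≤ ENNReal.ofReal (∑ _l : Fin k, starVariance (Fintype.card V))) :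
    ∃ hub : Fin k → V, H = fun l => SimpleGraph.starGraph (hub l) := by
  have : Nonempty V := Fintype.card_pos_iff.1 (by omega)
  rcases isTree_or_totalCost_eq_top hk x₀ hH with h | h
  · rw [totalCost_of_isTree x₀ h, ENNReal.ofReal_le_ofReal_iff
      (Finset.sum_nonneg fun _ _ => starVariance_nonneg _)] at hcost
    have hle := fun l (_ : l ∈ Finset.univ) => starVariance_le_treeVariance (h l)
    have heq := (Finset.sum_eq_sum_iff_of_le hle).1 (le_antisymm (Finset.sum_le_sum hle) hcost)
    choose hub hhub using fun l =>
      exists_eq_starGraph_of_treeVariance_le hn (h l) (heq l (Finset.mem_univ l)).ge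
    exact ⟨hub, funext hhub⟩
  · rw [h, top_le_iff] at hcost
    exact absurd hcost ENNReal.ofReal_ne_top

theorem isOptimal_iff (hn : 3 ≤ Fintype.card V) (hk : k = α * Fintype.card V)
    (x₀ : Fin k → V → ℝ) (H : Fin k → SimpleGraph V) :
    IsOptimal (⊤ : SimpleGraph V) (fun _ => 2 * α) x₀ H ↔
      ∃ hub : Fin k → V, (∀ l, H l = SimpleGraph.starGraph (hub l)) ∧
        ∀ v : V, {l | hub l = v}.ncard = α := by
  have : Nonempty V := Fintype.card_pos_iff.1 (by omega)
  constructor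
  · rintro ⟨hfeas, hmin⟩
    -- A balanced star assignment serves as competitor and caps the optimal cost at `k` stars.
    obtain ⟨hub', hhub'⟩ := exists_hub (V := V) hk
    obtain ⟨hub, rfl⟩ := exists_eq_starGraph_of_totalCost_le hn hk x₀ hfeas
      ((hmin _ (isFeasible_starGraph hhub')).trans_eq (totalCost_starGraph x₀ hub'))
    exact ⟨hub, fun _ => rfl, ncard_fiber_eq hn hk hfeas⟩
  · rintro ⟨hub, hH, hhub⟩
    obtain rfl : H = fun l => SimpleGraph.starGraph (hub l) := funext hH
    refine ⟨isFeasible_starGraph hhub, fun H' hH' => ?_⟩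
    rw [totalCost_starGraph]
    exact le_totalCost hk x₀ hH'

end Assignment

end ConsensusNetwork

theorem mainTheorem3 {V : Type*} [Fintype V] [DecidableEq V] (hn : 3 ≤ Fintype.card V)
    (α k : ℕ) (hk : k = α * Fintype.card V) (x₀ : Fin k → V → ℝ) :
    (∃ H : Fin k → SimpleGraph V,
      ConsensusNetwork.IsOptimal (⊤ : SimpleGraph V) (fun _ => 2 * α) x₀ H) ∧
    (∀ H H' : Fin k → SimpleGraph V,
      ConsensusNetwork.IsOptimal (⊤ : SimpleGraph V) (fun _ => 2 * α) x₀ H →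
      ConsensusNetwork.IsOptimal (⊤ : SimpleGraph V) (fun _ => 2 * α) x₀ H' →
      ∃ σ : Equiv.Perm (Fin k), ∀ l, H' l = H (σ l)) ∧
    (∀ H : Fin k → SimpleGraph V,
      ConsensusNetwork.IsOptimal (⊤ : SimpleGraph V) (fun _ => 2 * α) x₀ H ↔
      ∃ hub : Fin k → V, (∀ l, H l = SimpleGraph.starGraph (hub l)) ∧
        ∀ v : V, {l | hub l = v}.ncard = α) := by
  have hiff := ConsensusNetwork.isOptimal_iff hn hk x₀
  refine ⟨?_, fun H H' hH hH' => ?_, hiff⟩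
  · obtain ⟨hub, hhub⟩ := ConsensusNetwork.exists_hub (V := V) hk
    exact ⟨_, (hiff _).2 ⟨hub, fun _ => rfl, hhub⟩⟩
  · obtain ⟨hub, hstar, hcard⟩ := (hiff H).1 hH
    obtain ⟨hub', hstar', hcard'⟩ := (hiff H').1 hH'
    obtain ⟨σ, hσ⟩ := ConsensusNetwork.exists_perm_of_ncard_fiber_eq
      fun v => (hcard v).trans (hcard' v).symm
    exact ⟨σ, fun l => by rw [hstar', hstar, hσ]⟩
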